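/- Let $X$ be a complex Banach space and let $A:D(A)\subset X\to X$ (not necessarily densely defined) be the generator of an analytic semigroup $\mathrm{e}^{tA}$, $t\ge 0$, on $X$. That is: $\mathrm{e}^{0A}=I$; the semigroup law holds for positive times; $t\mapsto \mathrm{e}^{tA}$, $t>0$, has an operator-norm holomorphic extension to a sector around the positive half-line which is bounded near $0$ (strong continuity at $t=0$ is not required); and for all sufficiently large real $\mu$ the resolvent $(\mu-A)^{-1}$ exists and $(\mu-A)^{-1}x=\int_0^\infty \mathrm{e}^{-\mu t}\mathrm{e}^{tA}x\,\mathrm{d}t$ for all $x\in X$. For $0<\alpha<1$ and $1\le p\le\infty$ let $$D_A(\alpha,p)=\{x\in X:\ v(t)=\|t^{1-\alpha-1/p}A\mathrm{e}^{tA}x\|\in L^p(0,1)\},\qquad \|x\|_{D_A(\alpha,p)}=\|x\|+\|v\|_{L^p(0,1)},$$ and let $D_A(0,p)=X$. Let $0\le\alpha<1$ and let $X_\alpha$, with norm $\|\cdot\|_\alpha$, be any Banach space satisfying $D_A(\alpha,1)\subset X_\alpha\subset D_A(\alpha,\infty)$ with continuous embeddings (for $\alpha=0$ this means $X_0=X$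 up to an equivalent norm). Let $\varphi_0(z)=\mathrm{e}^z$ and $\varphi_k(z)=\int_0^1\mathrm{e}^{(1-\xi)z}\frac{\xi^{k-1}}{(k-1)!}\,\mathrm{d}\xi$ for $k\ge1$. Consider an $s$-stage exponential Runge--Kutta method with nodes $c_i\in[0,1]$ and weights $b_i(z)$ that are (finite) linear combinations of the functions $\varphi_k(z)$, $k\ge0$, and that satisfy the second-order conditions $$\sum_{i=1}^s b_i(z)=\varphi_1(z),\qquad \sum_{i=1}^s b_i(z)c_i=\varphi_2(z),\qquad z\in\mathbb{C}.$$ The operators $b_i(\tau A)$ are the same linear combinations of $\varphi_0(\tau A)=\mathrm{e}^{\tau A}$ and $\varphi_k(\tau A)=\int_0^1\mathrm{e}^{(1-\xi)\tau A}\frac{\xi^{k-1}}{(k-1)!}\,\mathrm{d}\xi$, $k\ge 1$. Let $T>0$ and $B\in\mathbb{R}$. Then there is a constant $C$, depending only on $A$, $\alpha$, $X_\alpha$, the method, $B$ and $T$, such that the following holds. Let $g:[0,T]\to X$ be differentiable on $[0,T]$ and twice differentiable on $(0,T]$ (one-sided derivatives at the end points), with $$\|g(t)\|,\ \|g'(t)\|\le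 B,\quad 0\le t\le T,\qquad \|g''(t)\|\le B\,t^{-1},\quad 0<t\le T.$$ Let $u_0\in X_\alpha$, let $$u(t)=\mathrm{e}^{tA}u_0+\int_0^t\mathrm{e}^{(t-\xi)A}g(\xi)\,\mathrm{d}\xi$$ be the mild solution of $u'=Au+g(t)$, $u(0)=u_0$, and for a step size $\tau>0$ let $t_n=n\tau$ and $$u_{n+1}=\mathrm{e}^{\tau A}u_n+\tau\sum_{i=1}^s b_i(\tau A)\,g(t_n+c_i\tau).$$ Then, for every $\tau>0$ and every integer $n\ge0$ with $t_n\le T$, both $u_n$ and $u(t_n)$ belong to $X_\alpha$ and $$\|u_n-u(t_n)\|_\alpha\le C\,\tau^{2-\alpha}\,(|\log\tau|+1).$$ -/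

import Mathlib

noncomputable section

namespace ERK

open MeasureTheory

/-- The open sector `{z ≠ 0 : |arg z| < θ}` in the complex plane. -/
def sector (θ : ℝ) : Set ℂ := {z | z ≠ 0 ∧ |z.arg| < θ}

section Semigroup

variable {X : Type*} [NormedAddCommGroup X] [NormedSpace ℂ X]

/-- `T` (used only at times `t ≥ 0`) is an analytic semigroup of bounded linear operators on `X`:
`T 0 = 1`, `T (t + s) = T t ∘ T s`, and `t ↦ T t`, `t > 0`, has a holomorphic extension to some
sector around the positive half-line, in the operator norm, which is bounded near the origin.
Strong continuity at `t = 0` is not required (generators need not be densely defined). -/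
structure IsAnalyticSemigroup (T : ℝ → X →L[ℂ] X) : Prop where
  map_zero : T 0 = 1
  map_add : ∀ t s : ℝ, 0 < t → 0 < s → T (t + s) = (T t).comp (T s)
  analytic : ∃ θ : ℝ, 0 < θ ∧ θ ≤ Real.pi / 2 ∧ ∃ S : ℂ → X →L[ℂ] X,
    (∀ t : ℝ, 0 < t → S (t : ℂ) = T t) ∧
    DifferentiableOn ℂ S (sector θ) ∧
    ∃ M : ℝ, ∀ z ∈ sector θ, ‖z‖ ≤ 1 → ‖S z‖ ≤ M

/-- The Laplace transform `∫₀^∞ e^{-μ t} T(t) x dt`. -/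
def laplace (T : ℝ → X →L[ℂ] X) (μ : ℝ) (x : X) : X :=
  ∫ t in Set.Ioi (0 : ℝ), Real.exp (-(μ * t)) • T t x

/-- The (not necessarily densely defined) operator `A : D(A) ⊂ X → X` is the generator of the
semigroup `T`: for all sufficiently large real `μ`, the operator `μ - A : D(A) → X` is bijective
and its inverse, the resolvent `(μ - A)⁻¹`, is the Laplace transform of `T`. -/
def IsGenerator (T : ℝ → X →L[ℂ] X) (A : X →ₗ.[ℂ] X) : Prop :=
  ∃ ω : ℝ, ∀ μ : ℝ, ω < μ →
    (∀ x : X, IntegrableOn (fun t : ℝ => Real.exp (-(μ * t)) • T t x) (Set.Ioi 0)) ∧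
    (∀ x : X, ∃ h : laplace T μ x ∈ A.domain,
      μ • laplace T μ x - A ⟨laplace T μ x, h⟩ = x) ∧
    (∀ y : A.domain, laplace T μ (μ • (y : X) - A y) = y)

open Classical in
/-- `A x`, extended by `0` outside `D(A)`; it is applied only to elements `e^{tA} x`, `t > 0`,
and these belong to `D(A)` if `A` generates an analytic semigroup. -/
def applyOp (A : X →ₗ.[ℂ] X) (x : X) : X :=
  if h : x ∈ A.domain then A ⟨x, h⟩ else 0

/-- The function `v(t) = ‖t^{1-α-1/p} A e^{tA} x‖` (with `1/∞ = 0`). -/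
def interpFun (T : ℝ → X →L[ℂ] X) (A : X →ₗ.[ℂ] X) (α : ℝ) (p : ENNReal) (x : X) (t : ℝ) : ℝ :=
  ‖t ^ (1 - α - p.toReal⁻¹) • applyOp A (T t x)‖

/-- Membership in the real interpolation space `D_A(α, p)`, with `D_A(0, p) = X`. -/
def MemInterp (T : ℝ → X →L[ℂ] X) (A : X →ₗ.[ℂ] X) (α : ℝ) (p : ENNReal) (x : X) : Prop :=
  α = 0 ∨ MemLp (interpFun T A α p x) p (volume.restrict (Set.Ioo (0 : ℝ) 1))

open Classical in
/-- The norm `‖x‖ + ‖v‖_{L^p(0,1)}` of `D_A(α, p)`, and the norm of `X` for `α = 0`. -/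
def interpNorm (T : ℝ → X →L[ℂ] X) (A : X →ₗ.[ℂ] X) (α : ℝ) (p : ENNReal) (x : X) : ℝ :=
  if α = 0 then ‖x‖
  else ‖x‖ + (eLpNorm (interpFun T A α p x) p (volume.restrict (Set.Ioo (0 : ℝ) 1))).toReal

/-- `D_A(α, 1) ⊂ Y ⊂ D_A(α, ∞)` with continuous embeddings, where the normed space `Y` is regarded
as a subspace of `X` by means of the injective linear map `ι`. -/
structure IsIntermediate {Y : Type*} [NormedAddCommGroup Y] [NormedSpace ℂ Y]
    (T : ℝ → X →L[ℂ] X) (A : X →ₗ.[ℂ] X) (α : ℝ) (ι : Y →ₗ[ℂ] X) : Prop where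
  injective : Function.Injective ι
  embeds_one : ∃ K : ℝ, ∀ x : X, MemInterp T A α 1 x →
    ∃ y : Y, ι y = x ∧ ‖y‖ ≤ K * interpNorm T A α 1 x
  embeds_top : ∃ K : ℝ, ∀ y : Y, MemInterp T A α ⊤ (ι y) ∧ interpNorm T A α ⊤ (ι y) ≤ K * ‖y‖

/-- The mild solution `u(t) = e^{tA} u₀ + ∫₀ᵗ e^{(t-ξ)A} g(ξ) dξ` of `u' = A u + g(t)`,
`u(0) = u₀`. -/
def mildSolution (T : ℝ → X →L[ℂ] X) (g : ℝ → X) (u₀ : X) (t : ℝ) : X :=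
  T t u₀ + ∫ ξ in (0 : ℝ)..t, T (t - ξ) (g ξ)

end Semigroup

/-- The entire functions `φ₀(z) = e^z` and
`φ_k(z) = ∫₀¹ e^{(1-ξ)z} ξ^{k-1} / (k-1)! dξ`, `k ≥ 1`. -/
def phi : ℕ → ℂ → ℂ
  | 0, z => Complex.exp z
  | k + 1, z => ∫ ξ in (0 : ℝ)..1, Complex.exp ((1 - ξ) * z) * ((ξ ^ k / (k.factorial : ℝ) : ℝ) : ℂ)

/-- The linear combination `b(z) = ∑_k a_k φ_k(z)` with coefficients `a_k`. -/
def weight (a : ℕ →₀ ℂ) (z : ℂ) : ℂ := a.sum fun k r => r * phi k z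

section Method

variable {X : Type*} [NormedAddCommGroup X] [NormedSpace ℂ X]

/-- The operators `φ₀(τA) = e^{τA}` and
`φ_k(τA) = ∫₀¹ e^{(1-ξ)τA} ξ^{k-1} / (k-1)! dξ`, `k ≥ 1`, where `T t = e^{tA}`. -/
def phiOp (T : ℝ → X →L[ℂ] X) : ℕ → ℝ → X →L[ℂ] X
  | 0, τ => T τ
  | k + 1, τ => ∫ ξ in (0 : ℝ)..1, (ξ ^ k / (k.factorial : ℝ)) • T ((1 - ξ) * τ)

/-- The operator `b(τA) = ∑_k a_k φ_k(τA)`. -/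
def weightOp (T : ℝ → X →L[ℂ] X) (a : ℕ →₀ ℂ) (τ : ℝ) : X →L[ℂ] X :=
  a.sum fun k r => r • phiOp T k τ

/-- The numerical solution of an `s`-stage exponential Runge-Kutta method with nodes `c i` and
weights `b_i = ∑_k (b i)_k φ_k`, step size `τ`, for `u' = A u + g(t)`:
`u_{n+1} = e^{τA} u_n + τ ∑_i b_i(τA) g(t_n + c_i τ)`, `t_n = n τ`. -/
def numSol (T : ℝ → X →L[ℂ] X) {s : ℕ} (b : Fin s → ℕ →₀ ℂ) (c : Fin s → ℝ)
    (g : ℝ → X) (τ : ℝ) (u₀ : X) : ℕ → X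
  | 0 => u₀
  | n + 1 => T τ (numSol T b c g τ u₀ n) +
      τ • ∑ i, weightOp T (b i) τ (g (n * τ + c i * τ))

end Method

end ERK

end

/-!
Write `T t = e^{tA}`, `t_n = n τ`, and let `J : X_α → X` be the continuous embedding.

*Smoothing.* A Cauchy estimate gives `‖T'(t)‖ ≤ C / t` on bounded intervals, and the Laplace
transform formula for the resolvent identifies `A T(t) x` with `T'(t) x`
(`IsGenerator.applyOp_eq`). Hence `T t` maps `X` into `D_A(α, 1) ⊂ X_α` with norm at most
`C t^{-α}` (`exists_interpNorm_le`), i.e. `T t = J ∘ E t` for operators `E t : X → X_α` with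
`‖E t‖ ≤ C t^{-α}` (`IsSmoothingLift`). These depend norm-continuously on `t > 0`, so that
convolutions with `T` are Bochner integrals in `X_α`: `∫₀ᵗ T(t - ξ) h(ξ) dξ` lies in `X_α` with
norm `O(t^{1-α} sup ‖h‖)`. The operators `τ φ_k(τA)`, `k ≥ 1`, are such convolutions, and `‖τ E τ‖`
is at most `C τ^{1-α}`, so the operators `τ b_i(τA)` map into `X_α` with norm `O(τ^{1-α})`.

*Order conditions.* As `φ_k(x) ~ e^x / x^k` for `x → +∞`, the functions `φ_k` are linearly
independent (`eq_zero_of_weight_eq_zero`). The order conditions are therefore identities between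
coefficient vectors, and carry over to the operators.

*Error.* The error is `∑_{k<n} T(t_{n-1-k}) d_k` with local errors `d_k`. By the order conditions
`d_k` does not change if an affine function is subtracted from `g` on the `k`-th step, which leaves
a remainder bounded by `B τ / max(k, 1)` (`exists_affine_approx`). Thus `d_k` is
`O(τ^{2-α} / max(k, 1))` in `X_α`, used for `k = n - 1`, and `O(τ² / max(k, 1))` in `X`. The latter
yields `O(τ^{2-α} / max(k, 1))` in `X_α` for the propagated errors with `k < n - 1`, because
`‖E(jτ)‖ ≤ C τ^{-α}` for `j ≥ 1`. The harmonic sum over `k` produces the factor `|log τ| + 1`.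
-/

noncomputable section

namespace ERK

open MeasureTheory Set Filter Topology

/-! ### The semigroup, its derivative and its generator -/

section Semigroup
variable {X : Type*} [NormedAddCommGroup X] [NormedSpace ℂ X]

/-- A sector contains, around each `t > 0`, a closed disc whose radius is proportional to `t`. -/
lemma exists_closedBall_subset_sector {θ : ℝ} (hθ : 0 < θ) :
    ∃ ρ : ℝ, 0 < ρ ∧ ρ < 1 ∧
      ∀ t : ℝ, 0 < t → Metric.closedBall (t : ℂ) (ρ * t) ⊆ sector θ := by
  have hcont : ContinuousAt Complex.arg 1 :=
    Complex.continuousAt_arg (by simp [Complex.slitPlane])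
  have hev : ∀ᶠ z in 𝓝 (1 : ℂ), |Complex.arg z| < θ := by
    have h := hcont.abs
    have h2 : ContinuousAt (fun z => |Complex.arg z|) 1 := h
    exact h2.eventually_lt_const (by simpa using hθ)
  obtain ⟨ε, hε, hball⟩ := Metric.eventually_nhds_iff_ball.1 hev
  refine ⟨min (ε / 2) (1 / 2), by positivity, by
    have := min_le_right (ε / 2) (1 / 2 : ℝ); linarith, fun t ht z hz => ?_⟩
  set ρ := min (ε / 2) (1 / 2 : ℝ) with hρ
  have hρ1 : ρ ≤ ε / 2 := min_le_left _ _
  have hρ2 : ρ ≤ 1 / 2 := min_le_right _ _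
  have htC : (t : ℂ) ≠ 0 := by exact_mod_cast ht.ne'
  have hw : dist (z / t) 1 ≤ ρ := by
    rw [Metric.mem_closedBall, dist_eq_norm] at hz
    rw [dist_eq_norm, show z / t - 1 = (z - t) / t by field_simp, norm_div,
      Complex.norm_real, Real.norm_of_nonneg ht.le, div_le_iff₀ ht]
    exact hz
  have hz' : z = (t : ℂ) * (z / t) := by field_simp
  refine ⟨?_, ?_⟩
  · rintro rfl
    simp [dist_eq_norm] at hw
    linarith
  · rw [hz', Complex.arg_real_mul _ ht]
    exact hball _ (by rw [Metric.mem_ball]; linarith)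

namespace IsAnalyticSemigroup

variable {T : ℝ → X →L[ℂ] X}

lemma add_of_nonneg (hT : IsAnalyticSemigroup T) {t s : ℝ} (ht : 0 ≤ t) (hs : 0 ≤ s) :
    T (t + s) = (T t).comp (T s) := by
  rcases ht.eq_or_lt with rfl | ht
  · simp [hT.map_zero]; rfl
  rcases hs.eq_or_lt with rfl | hs
  · simp [hT.map_zero]; rfl
  exact hT.map_add t s ht hs

lemma add_apply (hT : IsAnalyticSemigroup T) {t s : ℝ} (ht : 0 ≤ t) (hs : 0 ≤ s)
    (x : X) : T (t + s) x = T t (T s x) := by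
  rw [hT.add_of_nonneg ht hs]; rfl

/-- All that is needed from the holomorphic extension: boundedness and differentiability of the
semigroup, and the Cauchy estimate for its derivative. The restriction `t ≤ 1 / 2` keeps the circle
of radius `ρ t` around `t` inside the unit disc, where the extension is bounded. -/
lemma exists_norm_le_and_norm_deriv_le (hT : IsAnalyticSemigroup T) : ∃ (ρ M : ℝ), 0 < ρ ∧ 1 ≤ M ∧
    (∀ t, 0 < t → t ≤ 1 → ‖T t‖ ≤ M) ∧
    (∀ t, 0 < t → DifferentiableAt ℝ T t) ∧
    (∀ t, 0 < t → t ≤ 1 / 2 → ‖deriv T t‖ ≤ M / (ρ * t)) := by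
  obtain ⟨θ, hθ, -, S, hS, hd, M, hM⟩ := hT.analytic
  obtain ⟨ρ, hρ, hρ1, hball⟩ := exists_closedBall_subset_sector hθ
  have hmem : ∀ t : ℝ, 0 < t → (t : ℂ) ∈ sector θ := fun t ht =>
    hball t ht (Metric.mem_closedBall_self (by positivity))
  have hSd : ∀ t : ℝ, 0 < t → DifferentiableAt ℂ S t := fun t ht =>
    hd.differentiableAt (mem_of_superset (Metric.closedBall_mem_nhds _ (by positivity))
      (hball t ht))
  have hTd : ∀ t : ℝ, 0 < t → HasDerivAt T (deriv S t) t := fun t ht => by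
    have h : HasDerivAt (fun s : ℝ => S s) (deriv S t) t := by
      simpa [Function.comp_def] using
        (hSd t ht).hasDerivAt.scomp t Complex.ofRealCLM.hasDerivAt
    refine h.congr_of_eventuallyEq ?_
    filter_upwards [Ioi_mem_nhds ht] with s hs using (hS s hs).symm
  refine ⟨ρ, max M 1, hρ, le_max_right _ _, fun t ht ht1 => ?_,
    fun t ht => (hTd t ht).differentiableAt, fun t ht ht2 => ?_⟩
  · rw [← hS t ht]
    exact (hM _ (hmem t ht) (by
      rwa [Complex.norm_real, Real.norm_of_nonneg ht.le])).trans (le_max_left _ _)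
  · rw [(hTd t ht).deriv]
    refine Complex.norm_deriv_le_of_forall_mem_sphere_norm_le (by positivity) ?_ ?_
    · refine (hd.mono ?_).diffContOnCl_ball (subset_refl _)
      exact hball t ht
    · intro z hz
      have hz' := Metric.sphere_subset_closedBall hz
      refine (hM z (hball t ht hz') ?_).trans (le_max_left _ _)
      have h1 : ‖z‖ ≤ ‖(t : ℂ)‖ + ‖z - t‖ := by
        simpa using norm_add_le (t : ℂ) (z - t)
      rw [Complex.norm_real, Real.norm_of_nonneg ht.le] at h1
      rw [Metric.mem_closedBall, dist_eq_norm] at hz'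
      nlinarith

lemma differentiableAt (hT : IsAnalyticSemigroup T) {t : ℝ} (ht : 0 < t) :
    DifferentiableAt ℝ T t := by
  obtain ⟨_, _, _, _, _, h, _⟩ := hT.exists_norm_le_and_norm_deriv_le
  exact h t ht

lemma continuousOn (hT : IsAnalyticSemigroup T) : ContinuousOn T (Ioi 0) := fun _ ht =>
  (hT.differentiableAt ht).continuousAt.continuousWithinAt

lemma deriv_add (hT : IsAnalyticSemigroup T) {t s : ℝ} (ht : 0 < t) (hs : 0 ≤ s) :
    deriv T (s + t) = (T s).comp (deriv T t) := by
  have h1 : HasDerivAt (fun r => T (s + r)) (deriv T (s + t)) t :=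
    HasDerivAt.comp_const_add s t (hT.differentiableAt (by positivity)).hasDerivAt
  have h2 : HasDerivAt (fun r => (T s).comp (T r)) ((T s).comp (deriv T t)) t := by
    have := ((ContinuousLinearMap.compL ℂ X X X (T s)).restrictScalars
      ℝ).hasFDerivAt.comp_hasDerivAt t (hT.differentiableAt ht).hasDerivAt
    exact this
  refine h1.unique (h2.congr_of_eventuallyEq ?_)
  filter_upwards [Ioi_mem_nhds ht] with r hr using hT.add_of_nonneg hs (le_of_lt hr)

lemma exists_norm_le (hT : IsAnalyticSemigroup T) (t₀ : ℝ) :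
    ∃ M : ℝ, 0 ≤ M ∧ ∀ t, 0 < t → t ≤ t₀ → ‖T t‖ ≤ M := by
  obtain ⟨_, M, _, hM1, hM, _⟩ := hT.exists_norm_le_and_norm_deriv_le
  have key : ∀ n : ℕ, ∀ t : ℝ, 0 < t → t ≤ n + 1 → ‖T t‖ ≤ M ^ (n + 1) := by
    intro n
    induction n with
    | zero => intro t ht ht1; simpa using hM t ht (by simpa using ht1)
    | succ n ih =>
      intro t ht htn
      rcases le_or_gt t (n + 1) with h | h
      · exact (ih t ht h).trans (pow_le_pow_right₀ hM1 (by omega))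
      · have h0 : (0 : ℝ) ≤ n := n.cast_nonneg
        have h1 : 0 < t - 1 := by linarith
        push_cast at htn
        have h2 := hT.map_add (t - 1) 1 h1 one_pos
        rw [sub_add_cancel] at h2
        rw [h2, pow_succ]
        exact (ContinuousLinearMap.opNorm_comp_le _ _).trans
          (mul_le_mul (ih _ h1 (by linarith)) (hM 1 one_pos le_rfl) (norm_nonneg _)
            (by positivity))
  refine ⟨M ^ (⌈t₀⌉₊ + 1), by positivity, fun t ht htt => key _ t ht ?_⟩
  linarith [Nat.le_ceil t₀]

/-- The bound `‖A e^{tA}‖ ≤ C / t` on bounded time intervals: a Cauchy estimate for small `t`,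
extended to larger `t` by the semigroup law. -/
lemma exists_norm_deriv_le (hT : IsAnalyticSemigroup T) (t₀ : ℝ) :
    ∃ C : ℝ, 0 ≤ C ∧ ∀ t, 0 < t → t ≤ t₀ → ‖deriv T t‖ ≤ C / t := by
  obtain ⟨ρ, M, hρ, hM1, -, -, hM⟩ := hT.exists_norm_le_and_norm_deriv_le
  obtain ⟨N, hN0, hN⟩ := hT.exists_norm_le t₀
  refine ⟨M / ρ + N * (M / (ρ * (1 / 2))) * |t₀|, by positivity, fun t ht htt => ?_⟩
  rw [le_div_iff₀ ht]
  rcases le_or_gt t (1 / 2) with h | h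
  · have h1 := hM t ht h
    have h2 : ‖deriv T t‖ * t ≤ M / ρ := by
      calc _ ≤ M / (ρ * t) * t := by gcongr
        _ = M / ρ := by field_simp
    have : 0 ≤ N * (M / (ρ * (1 / 2))) * |t₀| := by positivity
    linarith
  · have h1 := hT.deriv_add (t := 1 / 2) (s := t - 1 / 2) (by norm_num) (by linarith)
    rw [sub_add_cancel] at h1
    have h2 : ‖deriv T t‖ ≤ N * (M / (ρ * (1 / 2))) := by
      rw [h1]
      exact (ContinuousLinearMap.opNorm_comp_le _ _).trans
        (mul_le_mul (hN _ (by linarith) (by linarith)) (hM _ (by norm_num) le_rfl)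
          (norm_nonneg _) hN0)
    have h3 : ‖deriv T t‖ * t ≤ N * (M / (ρ * (1 / 2))) * |t₀| := by
      gcongr
      exact htt.trans (le_abs_self _)
    have : 0 ≤ M / ρ := by positivity
    linarith

lemma continuousOn_deriv_apply (hT : IsAnalyticSemigroup T) (x : X) :
    ContinuousOn (fun t => deriv T t x) (Ioi 0) := by
  intro t ht
  have ht' : (0 : ℝ) < t := ht
  -- near `t` the derivative factors as `T (r - t / 2) ∘ T' (t / 2)`
  have h : ContinuousAt (fun r => T (r - t / 2) (deriv T (t / 2) x)) t := by
    have h1 : ContinuousAt (fun r => T (r - t / 2)) t := by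
      refine ContinuousAt.comp (f := fun r => r - t / 2) (g := T) ?_ (by fun_prop)
      exact (hT.differentiableAt (by linarith)).continuousAt
    exact h1.clm_apply continuousAt_const
  refine (h.congr ?_).continuousWithinAt
  filter_upwards [Ioi_mem_nhds (show t / 2 < t by linarith)] with r hr
  have hr' : t / 2 < r := hr
  have h1 := hT.deriv_add (t := t / 2) (s := r - t / 2) (by linarith) (by linarith)
  rw [sub_add_cancel] at h1
  rw [h1]; rfl

end IsAnalyticSemigroup

/-- For `t > 0` the range of `e^{tA}` lies in `D(A)` and `A e^{tA} x` is the time derivative.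
Integration by parts gives `(μ - A)⁻¹ (μ e^{tA} x - (d/dt) e^{tA} x) = e^{tA} x`. -/
lemma IsGenerator.applyOp_eq {T : ℝ → X →L[ℂ] X} {A : X →ₗ.[ℂ] X} [CompleteSpace X]
    (hA : IsGenerator T A) (hT : IsAnalyticSemigroup T) {t : ℝ} (ht : 0 < t) (x : X) :
    applyOp A (T t x) = deriv T t x := by
  obtain ⟨ω, hω⟩ := hA
  obtain ⟨hint, hdom, -⟩ := hω (ω + 1) (by linarith)
  set μ := ω + 1
  set z := μ • T t x - deriv T t x with hz
  have hder : ∀ s ∈ Ici (0 : ℝ), HasDerivAt (fun s => Real.exp (-(μ * s)) • T (s + t) x)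
      (-(Real.exp (-(μ * s)) • T s z)) s := by
    intro s hs
    have hs' : 0 ≤ s := hs
    have h1 : HasDerivAt (fun s => T (s + t) x) (deriv T (s + t) x) s := by
      have h := HasDerivAt.comp_add_const s t
        (hT.differentiableAt (t := s + t) (by positivity)).hasDerivAt
      exact ((ContinuousLinearMap.apply ℂ X x).restrictScalars ℝ).hasFDerivAt.comp_hasDerivAt s h
    have h2 : HasDerivAt (fun s => Real.exp (-(μ * s))) (Real.exp (-(μ * s)) * -(μ * 1)) s :=
      (((hasDerivAt_id s).const_mul μ).neg).exp
    refine (h2.smul h1).congr_deriv ?_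
    rw [hT.deriv_add ht hs', hT.add_apply hs' ht.le, hz, map_sub,
      ContinuousLinearMap.map_smul_of_tower]
    simp only [ContinuousLinearMap.comp_apply, smul_sub, neg_sub, mul_one, mul_smul, neg_smul,
      smul_neg]
    abel
  have hF' : IntegrableOn (fun s => -(Real.exp (-(μ * s)) • T s z)) (Ioi 0) := (hint z).neg
  have hF : IntegrableOn (fun s => Real.exp (-(μ * s)) • T (s + t) x) (Ioi 0) := by
    refine (hint (T t x)).congr_fun (fun s hs => ?_) measurableSet_Ioi
    have hs' : (0 : ℝ) < s := hs
    simp only [hT.add_apply hs'.le ht.le]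
  have hlim := tendsto_zero_of_hasDerivAt_of_integrableOn_Ioi
    (fun s hs => hder s (Ioi_subset_Ici_self hs)) hF' hF
  have hI := integral_Ioi_of_hasDerivAt_of_tendsto'
    (fun s hs => hder s hs) hF' hlim
  have hL : laplace T μ z = T t x := by
    rw [integral_neg] at hI
    simpa [laplace] using hI
  obtain ⟨h, hh⟩ := hdom z
  have hx : T t x ∈ A.domain := hL ▸ h
  have hAx : A ⟨laplace T μ z, h⟩ = A ⟨T t x, hx⟩ := by congr 1; exact Subtype.ext hL
  rw [hAx, hL, hz] at hh
  rw [applyOp, dif_pos hx]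
  exact sub_right_injective hh

end Semigroup

/-! ### Smoothing and lifts to the intermediate space -/

section Smoothing
variable {X : Type*} [NormedAddCommGroup X] [NormedSpace ℂ X]

/-- The kernel estimate behind the smoothing property: `∫₀¹ s^{-α} / (s + t) ds = O(t^{-α})`,
seen by splitting the integral at `s = t`. -/
lemma lintegral_rpow_div_add_le {α : ℝ} (hα₀ : 0 < α) (hα₁ : α < 1) {t : ℝ} (ht : 0 < t) :
    ∫⁻ s in Ioo (0 : ℝ) 1, ENNReal.ofReal (s ^ (-α) / (s + t)) ≤
      ENNReal.ofReal ((1 / (1 - α) + 1 / α) * t ^ (-α)) := by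
  have h1 : ∫⁻ s in Ioc 0 t, ENNReal.ofReal (s ^ (-α) / (s + t)) ≤
      ENNReal.ofReal (1 / (1 - α) * t ^ (-α)) := by
    have hi : IntegrableOn (fun s : ℝ => s ^ (-α) / t) (Ioc 0 t) := by
      have := (intervalIntegral.intervalIntegrable_rpow' (a := 0) (b := t)
        (show -1 < -α by linarith)).div_const t
      exact (intervalIntegrable_iff_integrableOn_Ioc_of_le ht.le).1 this
    have hv : ∫ s in Ioc 0 t, s ^ (-α) / t = 1 / (1 - α) * t ^ (-α) := by
      rw [← intervalIntegral.integral_of_le ht.le, intervalIntegral.integral_div,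
        integral_rpow (Or.inl (by linarith)), Real.zero_rpow (by linarith),
        Real.rpow_add ht, Real.rpow_one, show -α + 1 = 1 - α by ring]
      field_simp
      ring
    rw [← hv, ofReal_integral_eq_lintegral_ofReal hi]
    · refine setLIntegral_mono' measurableSet_Ioc fun s hs => ENNReal.ofReal_le_ofReal ?_
      exact div_le_div_of_nonneg_left (Real.rpow_nonneg hs.1.le _) ht (by linarith [hs.1])
    · refine (ae_restrict_iff' measurableSet_Ioc).2 (Eventually.of_forall fun s hs => ?_)
      exact div_nonneg (Real.rpow_nonneg hs.1.le _) ht.le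
  have h2 : ∫⁻ s in Ioi t, ENNReal.ofReal (s ^ (-α) / (s + t)) ≤
      ENNReal.ofReal (1 / α * t ^ (-α)) := by
    have hi := integrableOn_Ioi_rpow_of_lt (show -α - 1 < -1 by linarith) ht
    have hv : ∫ s in Ioi t, s ^ (-α - 1) = 1 / α * t ^ (-α) := by
      rw [integral_Ioi_rpow_of_lt (by linarith) ht, sub_add_cancel]
      field_simp
    rw [← hv, ofReal_integral_eq_lintegral_ofReal hi]
    · refine setLIntegral_mono' measurableSet_Ioi fun s hs => ENNReal.ofReal_le_ofReal ?_
      have hs' : t < s := hs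
      have hs0 : 0 < s := ht.trans hs'
      rw [Real.rpow_sub_one hs0.ne']
      exact div_le_div_of_nonneg_left (Real.rpow_nonneg hs0.le _) hs0 (by linarith)
    · refine (ae_restrict_iff' measurableSet_Ioi).2 (Eventually.of_forall fun s hs => ?_)
      exact Real.rpow_nonneg (ht.trans hs).le _
  have hα : 0 < 1 - α := by linarith
  calc _ ≤ ∫⁻ s in Ioc 0 t ∪ Ioi t, ENNReal.ofReal (s ^ (-α) / (s + t)) := by
        refine lintegral_mono_set fun s hs => ?_
        rw [Ioc_union_Ioi_eq_Ioi ht.le]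
        exact hs.1
    _ ≤ _ := lintegral_union_le _ _ _
    _ ≤ _ := add_le_add h1 h2
    _ = _ := by rw [← ENNReal.ofReal_add (by positivity) (by positivity), add_mul]

/-- The smoothing property of an analytic semigroup: `e^{tA}` maps `X` into `D_A(α, 1)`, with norm
`O(t^{-α})`. -/
lemma exists_interpNorm_le [CompleteSpace X] {T : ℝ → X →L[ℂ] X} {A : X →ₗ.[ℂ] X}
    (hT : IsAnalyticSemigroup T) (hA : IsGenerator T A) {α : ℝ} (hα₀ : 0 ≤ α) (hα₁ : α < 1)
    (t₀ : ℝ) :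
    ∃ C : ℝ, 0 ≤ C ∧ ∀ t, 0 < t → t ≤ t₀ → ∀ x : X, MemInterp T A α 1 (T t x) ∧
      interpNorm T A α 1 (T t x) ≤ C * t ^ (-α) * ‖x‖ := by
  obtain ⟨M, hM0, hM⟩ := hT.exists_norm_le t₀
  rcases hα₀.eq_or_lt with rfl | hα₀
  · refine ⟨M, hM0, fun t ht htt x => ⟨Or.inl rfl, ?_⟩⟩
    simp only [interpNorm, if_true, neg_zero, Real.rpow_zero, mul_one]
    exact (T t).le_of_opNorm_le (hM t ht htt) x
  obtain ⟨D, hD0, hD⟩ := hT.exists_norm_deriv_le (t₀ + 1)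
  have hα : 0 < 1 - α := by linarith
  set K := 1 / (1 - α) + 1 / α with hK
  have hK0 : 0 ≤ K := by positivity
  refine ⟨M * |t₀| ^ α + D * K, by positivity, fun t ht htt x => ?_⟩
  have hfun : ∀ s ∈ Ioo (0 : ℝ) 1, interpFun T A α 1 (T t x) s =
      ‖s ^ (-α) • deriv T (s + t) x‖ := by
    intro s hs
    have h1 : T s (T t x) = T (s + t) x := (hT.add_apply hs.1.le ht.le x).symm
    rw [interpFun, h1, hA.applyOp_eq hT (by linarith [hs.1])]
    simp
  have hmeas : AEStronglyMeasurable (interpFun T A α 1 (T t x))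
      (volume.restrict (Ioo (0 : ℝ) 1)) := by
    refine ContinuousOn.aestronglyMeasurable ?_ measurableSet_Ioo
    refine ContinuousOn.congr ?_ hfun
    have h1 : ContinuousOn (fun s : ℝ => s ^ (-α)) (Ioo 0 1) := fun s hs =>
      (Real.continuousAt_rpow_const _ _ (Or.inl hs.1.ne')).continuousWithinAt
    have h2 : ContinuousOn (fun s => deriv T (s + t) x) (Ioo 0 1) :=
      (hT.continuousOn_deriv_apply x).comp (by fun_prop)
        fun s hs => show 0 < s + t by linarith [hs.1]
    exact (h1.smul h2).norm
  have hle : eLpNorm (interpFun T A α 1 (T t x)) 1 (volume.restrict (Ioo (0 : ℝ) 1)) ≤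
      ENNReal.ofReal (D * K * t ^ (-α) * ‖x‖) := by
    rw [eLpNorm_one_eq_lintegral_enorm]
    calc _ ≤ ∫⁻ s in Ioo (0 : ℝ) 1,
          ENNReal.ofReal (D * ‖x‖) * ENNReal.ofReal (s ^ (-α) / (s + t)) := by
          refine setLIntegral_mono' measurableSet_Ioo fun s hs => ?_
          have hs0 := Real.rpow_nonneg hs.1.le (-α)
          rw [hfun s hs, enorm_norm, ← ENNReal.ofReal_mul (by positivity), ← ofReal_norm]
          refine ENNReal.ofReal_le_ofReal ?_
          rw [norm_smul, Real.norm_of_nonneg hs0]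
          have h := (deriv T (s + t)).le_of_opNorm_le
            (hD (s + t) (by linarith [hs.1]) (by linarith [hs.2])) x
          calc _ ≤ s ^ (-α) * (D / (s + t) * ‖x‖) := by gcongr
            _ = _ := by ring
      _ = ENNReal.ofReal (D * ‖x‖) *
          ∫⁻ s in Ioo (0 : ℝ) 1, ENNReal.ofReal (s ^ (-α) / (s + t)) :=
          lintegral_const_mul' _ _ ENNReal.ofReal_ne_top
      _ ≤ ENNReal.ofReal (D * ‖x‖) * ENNReal.ofReal (K * t ^ (-α)) := by
          gcongr
          exact lintegral_rpow_div_add_le hα₀ hα₁ ht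
      _ = _ := by
          rw [← ENNReal.ofReal_mul (by positivity)]
          congr 1; ring
  refine ⟨Or.inr ⟨hmeas, hle.trans_lt ENNReal.ofReal_lt_top⟩, ?_⟩
  rw [interpNorm, if_neg hα₀.ne']
  have h1 := ENNReal.toReal_le_of_le_ofReal (by positivity) hle
  have h2 : ‖T t x‖ ≤ M * ‖x‖ := (T t).le_of_opNorm_le (hM t ht htt) x
  have h3 : 1 ≤ |t₀| ^ α * t ^ (-α) := by
    rw [Real.rpow_neg ht.le, ← div_eq_mul_inv, le_div_iff₀ (by positivity), one_mul]
    exact Real.rpow_le_rpow ht.le (htt.trans (le_abs_self _)) hα₀.le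
  have h4 : M * ‖x‖ * 1 ≤ M * ‖x‖ * (|t₀| ^ α * t ^ (-α)) := by gcongr
  calc _ ≤ M * ‖x‖ * (|t₀| ^ α * t ^ (-α)) + D * K * t ^ (-α) * ‖x‖ := by linarith
    _ = _ := by ring

variable {Y : Type*} [NormedAddCommGroup Y] [NormedSpace ℂ Y]

/-- `E t : X → Y`, `0 < t ≤ t₀`, is the operator `T t` regarded as a map into the space `Y`, which
is embedded in `X` by `J`, and its norm is at most `C t^{-α}`. -/
structure IsSmoothingLift (T : ℝ → X →L[ℂ] X) (α t₀ C : ℝ) (J : Y →L[ℂ] X)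
    (E : ℝ → X →L[ℂ] Y) : Prop where
  injective : Function.Injective J
  apply_eq : ∀ t, 0 < t → t ≤ t₀ → ∀ x, J (E t x) = T t x
  nonneg : 0 ≤ C
  norm_le : ∀ t, 0 < t → t ≤ t₀ → ‖E t‖ ≤ C * t ^ (-α)

/-- The semigroup is its own lift to `Y = X`, with exponent `α = 0`. -/
lemma IsAnalyticSemigroup.exists_isSmoothingLift_self {T : ℝ → X →L[ℂ] X}
    (hT : IsAnalyticSemigroup T) (t₀ : ℝ) :
    ∃ C, IsSmoothingLift T 0 t₀ C (ContinuousLinearMap.id ℂ X) T := by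
  obtain ⟨M, hM0, hM⟩ := hT.exists_norm_le t₀
  exact ⟨M, fun _ _ h => h, fun _ _ _ _ => rfl, hM0, fun t ht htt => by simpa using hM t ht htt⟩

lemma IsIntermediate.exists_clm {T : ℝ → X →L[ℂ] X} {A : X →ₗ.[ℂ] X} {α : ℝ} {ι : Y →ₗ[ℂ] X}
    (hι : IsIntermediate T A α ι) : ∃ J : Y →L[ℂ] X, ∀ y, J y = ι y := by
  obtain ⟨K, hK⟩ := hι.embeds_top
  refine ⟨ι.mkContinuous K fun y => le_trans ?_ (hK y).2, fun y => rfl⟩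
  unfold interpNorm
  split_ifs
  · exact le_rfl
  · exact le_add_of_nonneg_right ENNReal.toReal_nonneg

lemma IsIntermediate.exists_isSmoothingLift [CompleteSpace X] {T : ℝ → X →L[ℂ] X}
    {A : X →ₗ.[ℂ] X} (hT : IsAnalyticSemigroup T) (hA : IsGenerator T A) {α : ℝ} (hα₀ : 0 ≤ α)
    (hα₁ : α < 1) {ι : Y →ₗ[ℂ] X} (hι : IsIntermediate T A α ι) {J : Y →L[ℂ] X}
    (hJ : ∀ y, J y = ι y) (t₀ : ℝ) :
    ∃ C E, IsSmoothingLift T α t₀ C J E := by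
  obtain ⟨C, hC0, hC⟩ := exists_interpNorm_le hT hA hα₀ hα₁ t₀
  obtain ⟨K, hK⟩ := hι.embeds_one
  have hlift : ∀ t, 0 < t → t ≤ t₀ → ∃ S : X →L[ℂ] Y, (∀ x, J (S x) = T t x) ∧
      ‖S‖ ≤ |K| * C * t ^ (-α) := by
    intro t ht htt
    choose S hS hSn using fun x => hK (T t x) (hC t ht htt x).1
    have hbound : ∀ x, ‖S x‖ ≤ |K| * C * t ^ (-α) * ‖x‖ := fun x => by
      have hn : 0 ≤ interpNorm T A α 1 (T t x) := by
        unfold interpNorm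
        split_ifs
        · exact norm_nonneg _
        · exact add_nonneg (norm_nonneg _) ENNReal.toReal_nonneg
      calc ‖S x‖ ≤ K * interpNorm T A α 1 (T t x) := hSn x
        _ ≤ |K| * interpNorm T A α 1 (T t x) := by gcongr; exact le_abs_self K
        _ ≤ |K| * (C * t ^ (-α) * ‖x‖) := by gcongr; exact (hC t ht htt x).2
        _ = _ := by ring
    let S' : X →ₗ[ℂ] Y :=
      { toFun := S
        map_add' := fun x y => hι.injective (by simp only [map_add, hS])
        map_smul' := fun r x => hι.injective (by simp only [map_smul, hS, RingHom.id_apply]) }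
    exact ⟨S'.mkContinuous _ hbound, fun x => (hJ _).trans (hS x),
      S'.mkContinuous_norm_le (by positivity) _⟩
  choose! E hE hEn using hlift
  refine ⟨|K| * C, E, ?_, hE, by positivity, hEn⟩
  intro y z h
  rw [hJ, hJ] at h
  exact hι.injective h

namespace IsSmoothingLift

variable {T : ℝ → X →L[ℂ] X} {α t₀ C : ℝ} {J : Y →L[ℂ] X} {E : ℝ → X →L[ℂ] Y}

/-- The lift is norm continuous, because `E t = E δ ∘ T (t - δ)` for `t > δ`. -/
lemma continuousOn (hE : IsSmoothingLift T α t₀ C J E) (hT : IsAnalyticSemigroup T) :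
    ContinuousOn E (Ioc 0 t₀) := by
  intro t ht
  have ht0 := ht.1
  have h1 : ContinuousAt (fun r => (E (t / 2)).comp (T (r - t / 2))) t := by
    have : ContinuousAt (fun r => T (r - t / 2)) t := by
      refine ContinuousAt.comp (f := fun r => r - t / 2) (g := T) ?_ (by fun_prop)
      exact (hT.differentiableAt (by linarith)).continuousAt
    exact continuousAt_const.clm_comp this
  refine h1.continuousWithinAt.congr_of_eventuallyEq_of_mem ?_ ht
  filter_upwards [self_mem_nhdsWithin,
    mem_nhdsWithin_of_mem_nhds (Ioi_mem_nhds (show t / 2 < t by linarith))] with r hr hr2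
  have hr2' : t / 2 < r := hr2
  ext x
  apply hE.injective
  rw [hE.apply_eq r hr.1 hr.2, ContinuousLinearMap.comp_apply,
    hE.apply_eq _ (by linarith) (by linarith [ht.2]),
    ← hT.add_apply (by linarith) (by linarith)]
  congr 2; ring

/-- The convolution `∫₀ᵗ e^{(t-ξ)A} h(ξ) dξ` takes values in `Y`, and one gains the power
`t^{1-α}`: it is the Bochner integral in `Y` of the lifted integrand. -/
lemma exists_integral_lift [CompleteSpace X] [CompleteSpace Y]
    (hE : IsSmoothingLift T α t₀ C J E) (hT : IsAnalyticSemigroup T)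
    (hα₁ : α < 1) {t : ℝ} (ht : 0 < t) (htt : t ≤ t₀) {h : ℝ → X}
    (hcont : ContinuousOn h (Icc 0 t)) {R : ℝ} (hR : ∀ ξ ∈ Icc 0 t, ‖h ξ‖ ≤ R) :
    IntervalIntegrable (fun ξ => T (t - ξ) (h ξ)) volume 0 t ∧
    ∃ y : Y, J y = ∫ ξ in (0 : ℝ)..t, T (t - ξ) (h ξ) ∧
      ‖y‖ ≤ C / (1 - α) * t ^ (1 - α) * R := by
  have hR0 : 0 ≤ R := (norm_nonneg _).trans (hR 0 ⟨le_rfl, ht.le⟩)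
  have hC0 := hE.nonneg
  have hbi : IntervalIntegrable (fun ξ : ℝ => C * (t - ξ) ^ (-α) * R) volume 0 t := by
    have h1 := (intervalIntegral.intervalIntegrable_rpow' (a := 0) (b := t)
      (show -1 < -α by linarith)).comp_sub_left t
    simp only [sub_zero, sub_self] at h1
    exact (h1.symm.const_mul C).mul_const R
  have hint : ∫ ξ in (0 : ℝ)..t, C * (t - ξ) ^ (-α) * R = C / (1 - α) * t ^ (1 - α) * R := by
    rw [intervalIntegral.integral_mul_const, intervalIntegral.integral_const_mul,
      intervalIntegral.integral_comp_sub_left (fun x => x ^ (-α)), sub_self, sub_zero,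
      integral_rpow (Or.inl (by linarith)), Real.zero_rpow (by linarith),
      show -α + 1 = 1 - α by ring]
    ring
  have hle : ∀ ξ ∈ Ioo 0 t, ‖E (t - ξ) (h ξ)‖ ≤ C * (t - ξ) ^ (-α) * R := by
    intro ξ hξ
    have h1 := hE.norm_le (t - ξ) (by linarith [hξ.2]) (by linarith [hξ.1])
    have h2 := hR ξ ⟨hξ.1.le, hξ.2.le⟩
    exact ((E (t - ξ)).le_opNorm _).trans (mul_le_mul h1 h2 (norm_nonneg _)
      ((norm_nonneg _).trans h1))
  have hcE : ContinuousOn (fun ξ => E (t - ξ) (h ξ)) (Ioo 0 t) := by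
    refine ContinuousOn.clm_apply ?_ (hcont.mono Ioo_subset_Icc_self)
    exact (hE.continuousOn hT).comp (by fun_prop)
      fun ξ hξ => ⟨by linarith [hξ.2], by linarith [hξ.1]⟩
  have hEi : IntervalIntegrable (fun ξ => E (t - ξ) (h ξ)) volume 0 t := by
    rw [intervalIntegrable_iff_integrableOn_Ioo_of_le ht.le] at hbi ⊢
    refine hbi.mono' (hcE.aestronglyMeasurable measurableSet_Ioo) ?_
    exact (ae_restrict_iff' measurableSet_Ioo).2 (Eventually.of_forall hle)
  have hcongr : ∀ ξ ∈ Ioo 0 t, J (E (t - ξ) (h ξ)) = T (t - ξ) (h ξ) := fun ξ hξ =>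
    hE.apply_eq _ (by linarith [hξ.2]) (by linarith [hξ.1]) _
  have hJi : IntervalIntegrable (fun ξ => J (E (t - ξ) (h ξ))) volume 0 t := by
    rw [intervalIntegrable_iff] at hEi ⊢
    exact J.integrable_comp hEi
  refine ⟨?_, ∫ ξ in (0 : ℝ)..t, E (t - ξ) (h ξ), ?_, ?_⟩
  · rw [intervalIntegrable_iff_integrableOn_Ioo_of_le ht.le] at hJi ⊢
    exact hJi.congr_fun hcongr measurableSet_Ioo
  · rw [← J.intervalIntegral_comp_comm hEi, intervalIntegral.integral_of_le ht.le,
      intervalIntegral.integral_of_le ht.le, integral_Ioc_eq_integral_Ioo,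
      integral_Ioc_eq_integral_Ioo]
    exact setIntegral_congr_fun measurableSet_Ioo hcongr
  · rw [← hint]
    refine intervalIntegral.norm_integral_le_of_norm_le ht.le ?_ hbi
    have : ∀ᵐ ξ : ℝ, ξ ≠ t := by simp [ae_iff]
    filter_upwards [this] with ξ hξ hξ' using hle ξ ⟨hξ'.1, lt_of_le_of_ne hξ'.2 hξ⟩

end IsSmoothingLift
end Smoothing

/-! ### Linear independence of the `φ`-functions -/

section Phi

lemma phi_succ_intervalIntegrable (k : ℕ) (z : ℂ) : IntervalIntegrable
    (fun ξ : ℝ => Complex.exp ((1 - ξ) * z) * ((ξ ^ k / (k.factorial : ℝ) : ℝ) : ℂ))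
    volume 0 1 := by
  refine Continuous.intervalIntegrable ?_ _ _
  fun_prop

/-- The recurrence `z φ_{k+1}(z) = φ_k(z) - 1 / k!`, by integration by parts. -/
lemma mul_phi_succ (k : ℕ) (z : ℂ) : z * phi (k + 1) z = phi k z - 1 / (k.factorial : ℂ) := by
  have hexp : ∀ ξ : ℝ, HasDerivAt (fun ξ : ℝ => Complex.exp ((1 - ξ) * z))
      (Complex.exp ((1 - ξ) * z) * (-z)) ξ := by
    intro ξ
    have h1 : HasDerivAt (fun ξ : ℝ => (1 - (ξ : ℂ)) * z) (-z) ξ := by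
      have h := ((Complex.ofRealCLM.hasDerivAt (x := ξ)).const_sub 1).mul_const z
      simpa using h
    exact h1.cexp
  cases k with
  | zero =>
    have h := intervalIntegral.integral_eq_sub_of_hasDerivAt (fun ξ _ => hexp ξ)
      (Continuous.intervalIntegrable (by fun_prop) (0 : ℝ) 1)
    rw [intervalIntegral.integral_mul_const] at h
    simp only [phi, pow_zero, Nat.factorial_zero, Nat.cast_one, div_one, Complex.ofReal_one,
      mul_one]
    simp at h
    linear_combination -h
  | succ k =>
    have hpow : ∀ ξ : ℝ, HasDerivAt
        (fun ξ : ℝ => ((ξ ^ (k + 1) / ((k + 1).factorial : ℝ) : ℝ) : ℂ))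
        ((ξ ^ k / (k.factorial : ℝ) : ℝ) : ℂ) ξ := by
      intro ξ
      have h1 := ((hasDerivAt_pow (k + 1) ξ).div_const ((k + 1).factorial : ℝ)).ofReal_comp
      refine h1.congr_deriv ?_
      congr 1
      rw [Nat.factorial_succ]
      have : (k.factorial : ℝ) ≠ 0 := by positivity
      push_cast
      field_simp
    have h := intervalIntegral.integral_eq_sub_of_hasDerivAt
      (fun ξ _ => (hexp ξ).mul (hpow ξ))
      (Continuous.intervalIntegrable (by fun_prop) (0 : ℝ) 1)
    have hi : IntervalIntegrable (fun ξ : ℝ => Complex.exp ((1 - ξ) * z) * (-z) *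
        ((ξ ^ (k + 1) / ((k + 1).factorial : ℝ) : ℝ) : ℂ)) volume 0 1 :=
      Continuous.intervalIntegrable (by fun_prop) _ _
    rw [intervalIntegral.integral_add hi (phi_succ_intervalIntegrable k z)] at h
    have h2 : ∫ ξ in (0 : ℝ)..1, Complex.exp ((1 - ξ) * z) * (-z) *
        ((ξ ^ (k + 1) / ((k + 1).factorial : ℝ) : ℝ) : ℂ) = -z * phi (k + 2) z := by
      rw [phi, ← intervalIntegral.integral_const_mul]
      congr 1; ext ξ; ring
    rw [h2] at h
    change -z * phi (k + 2) z + phi (k + 1) z = _ at h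
    simp at h
    rw [one_div]
    linear_combination -h

/-- On the real axis `φ_k(x) ~ e^x / x^k`, so the functions `φ_k` grow at different rates. -/
lemma tendsto_phi (k : ℕ) :
    Tendsto (fun x : ℝ => ((x ^ k * Real.exp (-x) : ℝ) : ℂ) * phi k x) atTop (𝓝 1) := by
  induction k with
  | zero =>
    refine tendsto_const_nhds.congr fun x => ?_
    simp [phi, ← Complex.exp_add]
  | succ k ih =>
    have h1 : Tendsto (fun x : ℝ => ((x ^ k * Real.exp (-x) : ℝ) : ℂ) * (1 / (k.factorial : ℂ)))
        atTop (𝓝 (((0 : ℝ) : ℂ) * (1 / (k.factorial : ℂ)))) :=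
      ((Complex.continuous_ofReal.tendsto _).comp
        (Real.tendsto_pow_mul_exp_neg_atTop_nhds_zero k)).mul_const _
    have h2 := ih.sub h1
    rw [Complex.ofReal_zero, zero_mul, sub_zero] at h2
    refine h2.congr fun x => ?_
    rw [← mul_sub, ← mul_phi_succ]
    push_cast
    ring

/-- The functions `φ_k` are linearly independent: in a vanishing combination the term with the
lowest index dominates on the positive real axis. -/
lemma eq_zero_of_weight_eq_zero {a : ℕ →₀ ℂ} (ha : ∀ z, weight a z = 0) : a = 0 := by
  ext k
  induction k using Nat.strong_induction_on with
  | _ k ih =>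
  have hterm : ∀ j ∈ a.support, Tendsto
      (fun x : ℝ => ((x ^ k * Real.exp (-x) : ℝ) : ℂ) * (a j * phi j x)) atTop
      (𝓝 (if j = k then a k else 0)) := by
    intro j _
    rcases lt_trichotomy j k with h | rfl | h
    · rw [ih j h]
      simp [h.ne]
    · have h1 := (tendsto_phi j).const_mul (a j)
      rw [if_pos rfl]
      rw [mul_one] at h1
      exact h1.congr fun x => by ring
    · have h1 : Tendsto (fun x : ℝ => (((x ^ (j - k))⁻¹ : ℝ) : ℂ)) atTop (𝓝 ((0 : ℝ) : ℂ)) :=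
        (Complex.continuous_ofReal.tendsto _).comp
          (tendsto_inv_atTop_zero.comp (tendsto_pow_atTop (by omega)))
      have h2 := (h1.mul (tendsto_phi j)).const_mul (a j)
      simp only [Complex.ofReal_zero, zero_mul, mul_zero] at h2
      rw [if_neg h.ne']
      refine h2.congr' ?_
      filter_upwards [eventually_gt_atTop 0] with x hx
      have hx' : (x : ℂ) ≠ 0 := by exact_mod_cast hx.ne'
      obtain ⟨m, rfl⟩ := Nat.exists_eq_add_of_le h.le
      rw [Nat.add_sub_cancel_left]
      push_cast
      rw [pow_add]
      field_simp
  have hsum := tendsto_finsetSum a.support hterm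
  have hzero : ∀ x : ℝ,
      ∑ j ∈ a.support, ((x ^ k * Real.exp (-x) : ℝ) : ℂ) * (a j * phi j x) = 0 := by
    intro x
    rw [← Finset.mul_sum]
    have := ha x
    rw [weight, Finsupp.sum] at this
    rw [this, mul_zero]
  simp only [hzero] at hsum
  have := tendsto_nhds_unique hsum tendsto_const_nhds
  rw [Finset.sum_ite_eq'] at this
  simpa using this

lemma weight_eq_linearCombination (a : ℕ →₀ ℂ) (z : ℂ) :
    weight a z = Finsupp.linearCombination ℂ (fun k => phi k z) a := by
  simp [weight, Finsupp.linearCombination_apply]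

lemma eq_single_of_weight_eq_phi {a : ℕ →₀ ℂ} {k : ℕ} (ha : ∀ z, weight a z = phi k z) :
    a = Finsupp.single k 1 := by
  rw [← sub_eq_zero]
  refine eq_zero_of_weight_eq_zero fun z => ?_
  rw [weight_eq_linearCombination, map_sub, ← weight_eq_linearCombination, ha]
  simp

variable {s : ℕ} {b : Fin s → ℕ →₀ ℂ}

/-- The first order condition as an identity between the coefficients of the weights. -/
lemma sum_weights_eq_single (h : ∀ z, ∑ i, weight (b i) z = phi 1 z) :
    ∑ i, b i = Finsupp.single 1 1 :=
  eq_single_of_weight_eq_phi fun z => by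
    rw [← h z, weight_eq_linearCombination, map_sum]
    simp only [weight_eq_linearCombination]

/-- The second order condition as an identity between the coefficients of the weights. -/
lemma sum_smul_weights_eq_single {c : Fin s → ℝ}
    (h : ∀ z, ∑ i, weight (b i) z * (c i : ℂ) = phi 2 z) :
    ∑ i, (c i : ℂ) • b i = Finsupp.single 2 1 :=
  eq_single_of_weight_eq_phi fun z => by
    rw [← h z, weight_eq_linearCombination, map_sum]
    simp only [weight_eq_linearCombination, map_smul, smul_eq_mul, mul_comm]

end Phi

/-! ### The operators `b_i(τA)` and the local error -/

section Operators
variable {X : Type*} [NormedAddCommGroup X] [NormedSpace ℂ X]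

lemma weightOp_eq_linearCombination (T : ℝ → X →L[ℂ] X) (a : ℕ →₀ ℂ) (τ : ℝ) :
    weightOp T a τ = Finsupp.linearCombination ℂ (fun k => phiOp T k τ) a := by
  simp [weightOp, Finsupp.linearCombination_apply]

/-- After the substitution `ξ ↦ ξ / τ`, `τ φ_{k+1}(τA) x` is a convolution with the semigroup. -/
lemma smul_phiOp_succ_apply [CompleteSpace X] {T : ℝ → X →L[ℂ] X} (hT : IsAnalyticSemigroup T)
    {τ : ℝ} (hτ : 0 < τ) (k : ℕ) (x : X) :
    τ • phiOp T (k + 1) τ x =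
      ∫ ξ in (0 : ℝ)..τ, T (τ - ξ) (((ξ / τ) ^ k / (k.factorial : ℝ)) • x) := by
  obtain ⟨M, hM0, hM⟩ := hT.exists_norm_le τ
  have hcont : ContinuousOn (fun ξ : ℝ => (ξ ^ k / (k.factorial : ℝ)) • T ((1 - ξ) * τ))
      (Ioo 0 1) := by
    have h1 : ContinuousOn (fun ξ : ℝ => T ((1 - ξ) * τ)) (Ioo 0 1) :=
      hT.continuousOn.comp (by fun_prop) fun ξ hξ => mul_pos (sub_pos.2 hξ.2) hτ
    have h2 : ContinuousOn (fun ξ : ℝ => ξ ^ k / (k.factorial : ℝ)) (Ioo 0 1) := by fun_prop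
    exact h2.smul h1
  have hint : IntervalIntegrable (fun ξ : ℝ => (ξ ^ k / (k.factorial : ℝ)) • T ((1 - ξ) * τ))
      volume 0 1 := by
    rw [intervalIntegrable_iff_integrableOn_Ioo_of_le zero_le_one]
    refine IntegrableOn.of_bound (by simp) (hcont.aestronglyMeasurable measurableSet_Ioo) M ?_
    refine (ae_restrict_iff' measurableSet_Ioo).2 (Eventually.of_forall fun ξ hξ => ?_)
    have h1 : ξ ^ k / (k.factorial : ℝ) ≤ 1 :=
      div_le_one_of_le₀ ((pow_le_one₀ hξ.1.le hξ.2.le).trans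
        (by exact_mod_cast k.factorial_pos)) (by positivity)
    have h0 : 0 ≤ ξ ^ k / (k.factorial : ℝ) := div_nonneg (pow_nonneg hξ.1.le _) (by positivity)
    have h2 := hM ((1 - ξ) * τ) (mul_pos (sub_pos.2 hξ.2) hτ) (by nlinarith [hξ.1])
    rw [norm_smul, Real.norm_of_nonneg h0]
    calc _ ≤ 1 * M := by gcongr
      _ = M := one_mul M
  have h1 : phiOp T (k + 1) τ x =
      ∫ ξ in (0 : ℝ)..1, (ξ ^ k / (k.factorial : ℝ)) • T ((1 - ξ) * τ) x := by
    rw [phiOp, ContinuousLinearMap.intervalIntegral_apply hint]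
    rfl
  have h2 := intervalIntegral.smul_integral_comp_mul_left (a := 0) (b := 1)
    (fun ξ => T (τ - ξ) (((ξ / τ) ^ k / (k.factorial : ℝ)) • x)) τ
  rw [mul_zero, mul_one] at h2
  rw [← h2, h1]
  congr 1
  refine intervalIntegral.integral_congr fun ξ _ => ?_
  rw [mul_div_cancel_left₀ _ hτ.ne', ContinuousLinearMap.map_smul_of_tower,
    show τ - τ * ξ = (1 - ξ) * τ by ring]

variable {Y : Type*} [NormedAddCommGroup Y] [NormedSpace ℂ Y]

/-- The operators `τ b(τA)` map `X` into `Y`, with the same gain `τ^{1-α}` as convolutions with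
the semigroup. -/
lemma IsSmoothingLift.exists_weightOp_lift [CompleteSpace X] [CompleteSpace Y]
    {T : ℝ → X →L[ℂ] X} {α t₀ C : ℝ} {J : Y →L[ℂ] X} {E : ℝ → X →L[ℂ] Y}
    (hE : IsSmoothingLift T α t₀ C J E) (hT : IsAnalyticSemigroup T) (hα₁ : α < 1)
    (a : ℕ →₀ ℂ) :
    ∃ K : ℝ, 0 ≤ K ∧ ∀ τ, 0 < τ → τ ≤ t₀ → ∀ x, ∃ y : Y,
      J y = τ • weightOp T a τ x ∧ ‖y‖ ≤ K * τ ^ (1 - α) * ‖x‖ := by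
  have hC0 := hE.nonneg
  have hα : 0 < 1 - α := by linarith
  simp only [weightOp_eq_linearCombination]
  induction a using Finsupp.induction_linear with
  | zero => exact ⟨0, le_rfl, fun τ _ _ x => ⟨0, by simp, by simp⟩⟩
  | add a a' iha iha' =>
    obtain ⟨K, hK0, hK⟩ := iha
    obtain ⟨K', hK0', hK'⟩ := iha'
    refine ⟨K + K', by positivity, fun τ hτ hτt x => ?_⟩
    obtain ⟨y, hy, hyn⟩ := hK τ hτ hτt x
    obtain ⟨y', hy', hyn'⟩ := hK' τ hτ hτt x
    refine ⟨y + y', ?_, ?_⟩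
    · rw [map_add, map_add, hy, hy', ← smul_add]
      rfl
    · refine (norm_add_le _ _).trans ?_
      linarith
  | single k r =>
    suffices h : ∃ K : ℝ, 0 ≤ K ∧ ∀ τ, 0 < τ → τ ≤ t₀ → ∀ x, ∃ y : Y,
        J y = τ • phiOp T k τ x ∧ ‖y‖ ≤ K * τ ^ (1 - α) * ‖x‖ by
      obtain ⟨K, hK0, hK⟩ := h
      refine ⟨‖r‖ * K, by positivity, fun τ hτ hτt x => ?_⟩
      obtain ⟨y, hy, hyn⟩ := hK τ hτ hτt x
      refine ⟨r • y, ?_, ?_⟩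
      · rw [map_smul, hy, Finsupp.linearCombination_single, smul_comm]
        rfl
      · rw [norm_smul, mul_assoc, mul_assoc, ← mul_assoc K]
        gcongr
    cases k with
    | zero =>
      refine ⟨C, hC0, fun τ hτ hτt x => ⟨τ • E τ x, ?_, ?_⟩⟩
      · rw [ContinuousLinearMap.map_smul_of_tower, hE.apply_eq τ hτ hτt]
        rfl
      · rw [norm_smul, Real.norm_of_nonneg hτ.le, sub_eq_add_neg, Real.rpow_add hτ, Real.rpow_one]
        calc τ * ‖E τ x‖ ≤ τ * (C * τ ^ (-α) * ‖x‖) := by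
              gcongr
              exact (E τ).le_of_opNorm_le (hE.norm_le τ hτ hτt) x
          _ = _ := by ring
    | succ k =>
      refine ⟨C / (1 - α), by positivity, fun τ hτ hτt x => ?_⟩
      rw [smul_phiOp_succ_apply hT hτ]
      refine (hE.exists_integral_lift hT hα₁ hτ hτt (Continuous.continuousOn (by fun_prop))
        fun ξ hξ => ?_).2
      have h0 : 0 ≤ ξ / τ := div_nonneg hξ.1 hτ.le
      have h1 : (ξ / τ) ^ k / (k.factorial : ℝ) ≤ 1 :=
        div_le_one_of_le₀ ((pow_le_one₀ h0 (div_le_one_of_le₀ hξ.2 hτ.le)).trans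
          (by exact_mod_cast k.factorial_pos)) (by positivity)
      rw [norm_smul, Real.norm_of_nonneg (by positivity)]
      calc _ ≤ 1 * ‖x‖ := by gcongr
        _ = ‖x‖ := one_mul _

/-- The defect `τ ∑ b_i(τA) r(c_i τ) - ∫₀^τ e^{(τ-ξ)A} r(ξ) dξ` of the method over one step, for
the inhomogeneity `r`. -/
def localError (T : ℝ → X →L[ℂ] X) {s : ℕ} (b : Fin s → ℕ →₀ ℂ) (c : Fin s → ℝ) (τ : ℝ)
    (r : ℝ → X) : X :=
  τ • ∑ i, weightOp T (b i) τ (r (c i * τ)) - ∫ ξ in (0 : ℝ)..τ, T (τ - ξ) (r ξ)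

variable {T : ℝ → X →L[ℂ] X} {s : ℕ} {b : Fin s → ℕ →₀ ℂ} {c : Fin s → ℝ}

lemma IsSmoothingLift.exists_localError_lift [CompleteSpace X] [CompleteSpace Y]
    {α t₀ C : ℝ} {J : Y →L[ℂ] X} {E : ℝ → X →L[ℂ] Y}
    (hE : IsSmoothingLift T α t₀ C J E) (hT : IsAnalyticSemigroup T) (hα₁ : α < 1)
    (b : Fin s → ℕ →₀ ℂ) (hc : ∀ i, c i ∈ Icc (0 : ℝ) 1) :
    ∃ K : ℝ, 0 ≤ K ∧ ∀ τ, 0 < τ → τ ≤ t₀ → ∀ (r : ℝ → X) (R : ℝ), ContinuousOn r (Icc 0 τ) →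
      (∀ ξ ∈ Icc 0 τ, ‖r ξ‖ ≤ R) →
      ∃ y : Y, J y = localError T b c τ r ∧ ‖y‖ ≤ K * τ ^ (1 - α) * R := by
  have hC0 := hE.nonneg
  have hα : 0 < 1 - α := by linarith
  choose K hK0 hK using fun i => hE.exists_weightOp_lift hT hα₁ (b i)
  refine ⟨∑ i, K i + C / (1 - α), add_nonneg (Finset.sum_nonneg fun i _ => hK0 i)
    (by positivity), fun τ hτ hτt r R hr hR => ?_⟩
  obtain ⟨-, z, hz, hzn⟩ := hE.exists_integral_lift hT hα₁ hτ hτt hr hR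
  choose y hy hyn using fun i => hK i τ hτ hτt (r (c i * τ))
  refine ⟨∑ i, y i - z, ?_, ?_⟩
  · rw [map_sub, map_sum, hz, localError, Finset.smul_sum]
    simp only [hy]
  · have h1 : ∀ i ∈ Finset.univ, ‖y i‖ ≤ K i * (τ ^ (1 - α) * R) := fun i _ => by
      rw [← mul_assoc]
      refine (hyn i).trans (mul_le_mul_of_nonneg_left (hR _ ?_)
        (mul_nonneg (hK0 i) (Real.rpow_nonneg hτ.le _)))
      have := hc i
      exact ⟨mul_nonneg this.1 hτ.le, mul_le_of_le_one_left hτ.le this.2⟩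
    have h2 := (norm_sum_le _ _).trans (Finset.sum_le_sum h1)
    rw [← Finset.sum_mul] at h2
    refine (norm_sub_le _ _).trans ?_
    linarith

/-- By the first order condition the method is exact for constants, and by the second one for
`ξ ↦ ξ v`; hence subtracting an affine function does not change the local error. -/
lemma localError_sub_affine [CompleteSpace X] (hT : IsAnalyticSemigroup T)
    (h₁ : ∑ i, b i = Finsupp.single 1 1)
    (h₂ : ∑ i, (c i : ℂ) • b i = Finsupp.single 2 1) (w v : X)
    {τ : ℝ} (hτ : 0 < τ) {r : ℝ → X} (hr : ContinuousOn r (Icc 0 τ)) :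
    localError T b c τ (fun ξ => r ξ - (w + ξ • v)) = localError T b c τ r := by
  obtain ⟨C, hC⟩ := hT.exists_isSmoothingLift_self τ
  have hI : ∀ h : ℝ → X, ContinuousOn h (Icc 0 τ) →
      IntervalIntegrable (fun ξ => T (τ - ξ) (h ξ)) volume 0 τ := by
    intro h hh
    obtain ⟨R, hR⟩ := isCompact_Icc.exists_bound_of_continuousOn hh
    exact (hC.exists_integral_lift hT zero_lt_one hτ le_rfl hh hR).1
  have hw : ∑ i, weightOp T (b i) τ w = phiOp T 1 τ w := by
    rw [← _root_.sum_apply]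
    simp only [weightOp_eq_linearCombination]
    rw [← map_sum, h₁]
    simp
  have hv : ∑ i, weightOp T (b i) τ ((c i * τ) • v) = phiOp T 2 τ (τ • v) := by
    have h : ∑ i, (c i : ℂ) • weightOp T (b i) τ = phiOp T 2 τ := by
      simp only [weightOp_eq_linearCombination, ← map_smul]
      rw [← map_sum, h₂]
      simp
    rw [← h, _root_.sum_apply]
    refine Finset.sum_congr rfl fun i _ => ?_
    rw [mul_smul, ContinuousLinearMap.map_smul_of_tower, _root_.smul_apply,
      Complex.coe_smul]
  have hwI : τ • phiOp T 1 τ w = ∫ ξ in (0 : ℝ)..τ, T (τ - ξ) w := by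
    simpa using smul_phiOp_succ_apply hT hτ 0 w
  have hvI : τ • phiOp T 2 τ (τ • v) = ∫ ξ in (0 : ℝ)..τ, T (τ - ξ) (ξ • v) := by
    rw [smul_phiOp_succ_apply hT hτ 1]
    refine intervalIntegral.integral_congr fun ξ _ => ?_
    simp only [pow_one, Nat.factorial_one, Nat.cast_one, div_one, smul_smul]
    rw [div_mul_cancel₀ _ hτ.ne']
  unfold localError
  simp only [map_sub, map_add]
  rw [Finset.sum_sub_distrib, Finset.sum_add_distrib, hw, hv, smul_sub, smul_add, hwI, hvI,
    intervalIntegral.integral_sub (hI r hr), intervalIntegral.integral_add]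
  · abel
  · exact hI _ (by fun_prop)
  · exact hI _ (by fun_prop)
  · exact (hI _ (by fun_prop)).add (hI (fun ξ => ξ • v) (by fun_prop))

end Operators

/-! ### Taylor remainders and the error recursion -/

section Taylor
variable {X : Type*} [NormedAddCommGroup X] [NormedSpace ℂ X]

/-- On the `k`-th step, `g` is within `B τ / max(k, 1)` of an affine function. For `k ≥ 1` this is
its first order Taylor polynomial, since `‖g''‖ ≤ B / (k τ)` there; for `k = 0`, where `g''` may be
singular, it is a constant. -/
lemma exists_affine_approx {tEnd B : ℝ} {g g' g'' : ℝ → X}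
    (hg : ∀ t ∈ Icc 0 tEnd, HasDerivWithinAt g (g' t) (Icc 0 tEnd) t)
    (hg' : ∀ t ∈ Ioc 0 tEnd, HasDerivWithinAt g' (g'' t) (Icc 0 tEnd) t)
    (hB : ∀ t ∈ Icc 0 tEnd, ‖g' t‖ ≤ B) (hB'' : ∀ t ∈ Ioc 0 tEnd, ‖g'' t‖ ≤ B * t⁻¹)
    {τ : ℝ} (hτ : 0 < τ) {k : ℕ} (hk : k * τ + τ ≤ tEnd) :
    ∃ w v : X, ∀ ξ ∈ Icc 0 τ, ‖g (k * τ + ξ) - (w + ξ • v)‖ ≤ B * τ * (max (k : ℝ) 1)⁻¹ := by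
  have hkτ : 0 ≤ k * τ := by positivity
  have hB0 : 0 ≤ B := (norm_nonneg _).trans (hB 0 ⟨le_rfl, by linarith⟩)
  rcases k.eq_zero_or_pos with rfl | hk0
  · refine ⟨g 0, 0, fun ξ hξ => ?_⟩
    have h1 := (convex_Icc 0 tEnd).norm_image_sub_le_of_norm_hasDerivWithin_le hg hB
      (x := 0) (y := ξ) ⟨le_rfl, by linarith⟩ ⟨hξ.1, by simp at hk; linarith [hξ.2]⟩
    rw [sub_zero, Real.norm_of_nonneg hξ.1] at h1
    simpa using h1.trans (mul_le_mul_of_nonneg_left hξ.2 hB0)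
  · set a := k * τ with ha
    have hk1 : (1 : ℝ) ≤ k := by exact_mod_cast hk0
    have ha0 : 0 < a := by positivity
    have hsub : Icc a (a + τ) ⊆ Icc 0 tEnd := Icc_subset_Icc ha0.le hk
    have hmem : a ∈ Icc a (a + τ) := ⟨le_rfl, by linarith⟩
    have hlip : ∀ t ∈ Icc a (a + τ), ‖g' t - g' a‖ ≤ B * a⁻¹ * τ := by
      intro t ht
      have h1 := (convex_Icc a (a + τ)).norm_image_sub_le_of_norm_hasDerivWithin_le (C := B * a⁻¹)
        (fun x hx => (hg' x ⟨ha0.trans_le hx.1, (hsub hx).2⟩).mono hsub)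
        (fun x hx => (hB'' x ⟨ha0.trans_le hx.1, (hsub hx).2⟩).trans (by
          have := hx.1
          gcongr)) hmem ht
      refine h1.trans (mul_le_mul_of_nonneg_left ?_ (by positivity))
      rw [Real.norm_of_nonneg (by linarith [ht.1])]
      linarith [ht.2]
    have hder : ∀ t ∈ Icc a (a + τ), HasDerivWithinAt (fun t => g t - t • g' a)
        (g' t - g' a) (Icc a (a + τ)) t := by
      intro t ht
      have h1 : HasDerivWithinAt (fun t : ℝ => t • g' a) ((1 : ℝ) • g' a) (Icc a (a + τ)) t :=
        (hasDerivWithinAt_id t _).smul_const _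
      rw [one_smul] at h1
      exact ((hg t (hsub ht)).mono hsub).sub h1
    refine ⟨g a, g' a, fun ξ hξ => ?_⟩
    have h1 := (convex_Icc a (a + τ)).norm_image_sub_le_of_norm_hasDerivWithin_le hder hlip hmem
      (y := a + ξ) ⟨by linarith [hξ.1], by linarith [hξ.2]⟩
    rw [add_sub_cancel_left, Real.norm_of_nonneg hξ.1] at h1
    have h2 : g (a + ξ) - (g a + ξ • g' a) = g (a + ξ) - (a + ξ) • g' a - (g a - a • g' a) := by
      rw [add_smul]; abel
    rw [h2, max_eq_left hk1]
    refine h1.trans ?_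
    calc B * a⁻¹ * τ * ξ ≤ B * a⁻¹ * τ * τ := by gcongr; exact hξ.2
      _ = _ := by rw [ha]; field_simp

lemma sum_range_inv_max_le (n : ℕ) :
    ∑ k ∈ Finset.range (n + 1), (max (k : ℝ) 1)⁻¹ ≤ 2 + Real.log (n + 1) := by
  have h1 : ∑ k ∈ Finset.range (n + 1), (max (k : ℝ) 1)⁻¹ = (harmonic n : ℝ) + 1 := by
    rw [Finset.sum_range_succ', harmonic]
    push_cast
    simp
  have h2 := harmonic_le_one_add_log n
  have h3 : Real.log n ≤ Real.log (n + 1) := by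
    rcases n.eq_zero_or_pos with rfl | hn
    · simp
    · exact Real.log_le_log (by exact_mod_cast hn) (by linarith)
  linarith

end Taylor

section GlobalError
variable {X : Type*} [NormedAddCommGroup X] [NormedSpace ℂ X] [CompleteSpace X]
  {T : ℝ → X →L[ℂ] X} {s : ℕ} {b : Fin s → ℕ →₀ ℂ} {c : Fin s → ℝ}

lemma mildSolution_add (hT : IsAnalyticSemigroup T) {t τ : ℝ} (ht : 0 ≤ t) (hτ : 0 < τ)
    {g : ℝ → X} (hg : ContinuousOn g (Icc 0 (t + τ))) (u₀ : X) :
    mildSolution T g u₀ (t + τ) =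
      T τ (mildSolution T g u₀ t) + ∫ ξ in (0 : ℝ)..τ, T (τ - ξ) (g (t + ξ)) := by
  have hI : ∀ r, 0 ≤ r → r ≤ t + τ →
      IntervalIntegrable (fun ξ => T (r - ξ) (g ξ)) volume 0 r := by
    intro r hr hrt
    rcases hr.eq_or_lt with rfl | hr
    · exact IntervalIntegrable.refl
    obtain ⟨C, hC⟩ := hT.exists_isSmoothingLift_self r
    have hg' := hg.mono (Icc_subset_Icc_right hrt)
    obtain ⟨R, hR⟩ := isCompact_Icc.exists_bound_of_continuousOn hg'
    exact (hC.exists_integral_lift hT zero_lt_one hr le_rfl hg' hR).1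
  have hfull := hI (t + τ) (by positivity) le_rfl
  have hfst : IntervalIntegrable (fun ξ => T (t + τ - ξ) (g ξ)) volume 0 t :=
    hfull.mono_set (uIcc_subset_uIcc left_mem_uIcc (mem_uIcc.2 (Or.inl ⟨ht, by linarith⟩)))
  have hsnd : IntervalIntegrable (fun ξ => T (t + τ - ξ) (g ξ)) volume t (t + τ) :=
    hfull.mono_set (uIcc_subset_uIcc (mem_uIcc.2 (Or.inl ⟨ht, by linarith⟩)) right_mem_uIcc)
  have h1 : ∫ ξ in (0 : ℝ)..t, T (t + τ - ξ) (g ξ) =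
      T τ (∫ ξ in (0 : ℝ)..t, T (t - ξ) (g ξ)) := by
    rw [← (T τ).intervalIntegral_comp_comm (hI t ht (by linarith))]
    refine intervalIntegral.integral_congr fun ξ hξ => ?_
    rw [uIcc_of_le ht] at hξ
    rw [← hT.add_apply hτ.le (by linarith [hξ.2])]
    congr 2; ring
  have h2 : ∫ ξ in t..(t + τ), T (t + τ - ξ) (g ξ) =
      ∫ ξ in (0 : ℝ)..τ, T (τ - ξ) (g (t + ξ)) := by
    have := intervalIntegral.integral_comp_add_left (a := 0) (b := τ)
      (fun ξ => T (t + τ - ξ) (g ξ)) t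
    rw [add_zero] at this
    rw [← this]
    refine intervalIntegral.integral_congr fun ξ _ => ?_
    rw [add_sub_add_left_eq_sub]
  rw [mildSolution, mildSolution, map_add, ← intervalIntegral.integral_add_adjacent_intervals
    hfst hsnd, h1, h2, add_comm t τ, hT.add_apply hτ.le ht, add_assoc]

/-- The error is the sum of the propagated local errors. -/
lemma numSol_sub_mildSolution (hT : IsAnalyticSemigroup T) {τ : ℝ} (hτ : 0 < τ) {g : ℝ → X}
    (u₀ : X) (n : ℕ) (hg : ContinuousOn g (Icc 0 (n * τ))) :
    numSol T b c g τ u₀ n - mildSolution T g u₀ (n * τ) =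
      ∑ k ∈ Finset.range n,
        T ((n - 1 - k : ℕ) * τ) (localError T b c τ fun ξ => g (k * τ + ξ)) := by
  induction n with
  | zero => simp [numSol, mildSolution, hT.map_zero]
  | succ n ih =>
    have hn : ((n + 1 : ℕ) : ℝ) * τ = n * τ + τ := by push_cast; ring
    rw [hn] at hg ⊢
    have ih := ih (hg.mono (Icc_subset_Icc_right (by linarith)))
    have h1 : ∀ k ∈ Finset.range n,
        T ((n + 1 - 1 - k : ℕ) * τ) (localError T b c τ fun ξ => g (k * τ + ξ)) =
        T τ (T ((n - 1 - k : ℕ) * τ) (localError T b c τ fun ξ => g (k * τ + ξ))) := by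
      intro k hk
      have hk' := Finset.mem_range.1 hk
      rw [← hT.add_apply hτ.le (by positivity),
        show n + 1 - 1 - k = n - 1 - k + 1 by omega]
      congr 2
      push_cast; ring
    rw [Finset.sum_range_succ, Finset.sum_congr rfl h1, ← map_sum, ← ih,
      mildSolution_add hT (by positivity) hτ hg, numSol, localError, map_sub]
    simp [hT.map_zero]
    abel

end GlobalError

/-! ### The error bound -/

/-- The error bound with the logarithmic factor still in the form of a harmonic sum: the last
local error is estimated directly in `Y`, the others by smoothing over at least one step. -/
lemma exists_error_lift
    {X : Type*} [NormedAddCommGroup X] [NormedSpace ℂ X] [CompleteSpace X]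
    {Y : Type*} [NormedAddCommGroup Y] [NormedSpace ℂ Y] [CompleteSpace Y]
    {T : ℝ → X →L[ℂ] X} (hT : IsAnalyticSemigroup T) {α t₀ C : ℝ} (hα₀ : 0 ≤ α) (hα₁ : α < 1)
    {J : Y →L[ℂ] X} {E : ℝ → X →L[ℂ] Y} (hE : IsSmoothingLift T α t₀ C J E)
    {s : ℕ} (b : Fin s → ℕ →₀ ℂ) {c : Fin s → ℝ} (hc : ∀ i, c i ∈ Icc (0 : ℝ) 1)
    (h₁ : ∑ i, b i = Finsupp.single 1 1) (h₂ : ∑ i, (c i : ℂ) • b i = Finsupp.single 2 1) :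
    ∃ K : ℝ, 0 ≤ K ∧ ∀ (B : ℝ) (g g' g'' : ℝ → X),
      (∀ t ∈ Icc 0 t₀, HasDerivWithinAt g (g' t) (Icc 0 t₀) t) →
      (∀ t ∈ Ioc 0 t₀, HasDerivWithinAt g' (g'' t) (Icc 0 t₀) t) →
      (∀ t ∈ Icc 0 t₀, ‖g' t‖ ≤ B) → (∀ t ∈ Ioc 0 t₀, ‖g'' t‖ ≤ B * t⁻¹) →
      ∀ (u₀ : X) (τ : ℝ), 0 < τ → ∀ n : ℕ, (n : ℝ) * τ ≤ t₀ →
        ∃ y : Y, J y = numSol T b c g τ u₀ n - mildSolution T g u₀ (n * τ) ∧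
          ‖y‖ ≤ K * B * τ ^ (2 - α) * ∑ k ∈ Finset.range n, (max (k : ℝ) 1)⁻¹ := by
  have hC0 := hE.nonneg
  obtain ⟨C₀, hC₀⟩ := hT.exists_isSmoothingLift_self t₀
  obtain ⟨K₁, hK₁0, hK₁⟩ := hE.exists_localError_lift hT hα₁ b hc
  obtain ⟨K₂, hK₂0, hK₂⟩ := hC₀.exists_localError_lift hT zero_lt_one b hc
  refine ⟨K₁ + C * K₂, by positivity, ?_⟩
  intro B g g' g'' hg hg' hB hB'' u₀ τ hτ n hn
  have hgc : ContinuousOn g (Icc 0 t₀) := fun t ht => (hg t ht).continuousWithinAt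
  have hterm : ∀ k ∈ Finset.range n, ∃ y : Y,
      J y = T ((n - 1 - k : ℕ) * τ) (localError T b c τ fun ξ => g (k * τ + ξ)) ∧
      ‖y‖ ≤ (K₁ + C * K₂) * B * τ ^ (2 - α) * (max (k : ℝ) 1)⁻¹ := by
    intro k hk
    have hk' : k + 1 ≤ n := Finset.mem_range.1 hk
    have hk1 : k * τ + τ ≤ t₀ := by
      have : ((k + 1 : ℕ) : ℝ) * τ ≤ n * τ := by gcongr
      push_cast at this
      linarith
    have hkτ : 0 ≤ k * τ := by positivity
    have hτt : τ ≤ t₀ := by linarith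
    have hB0 : 0 ≤ B := (norm_nonneg _).trans (hB 0 ⟨le_rfl, by linarith⟩)
    set R := B * τ * (max (k : ℝ) 1)⁻¹ with hRdef
    have hR0 : 0 ≤ R := by positivity
    obtain ⟨w, v, hwv⟩ := exists_affine_approx hg hg' hB hB'' hτ hk1
    have hcont : ContinuousOn (fun ξ => g (k * τ + ξ)) (Icc 0 τ) :=
      hgc.comp (by fun_prop) fun ξ hξ => ⟨by linarith [hξ.1], by linarith [hξ.2]⟩
    have hcont' : ContinuousOn (fun ξ => g (k * τ + ξ) - (w + ξ • v)) (Icc 0 τ) :=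
      hcont.sub (by fun_prop)
    have hpow : τ ^ (2 - α) = τ ^ (1 - α) * τ := by
      rw [← Real.rpow_add_one hτ.ne']; congr 1; ring
    have hgoal : (K₁ + C * K₂) * B * τ ^ (2 - α) * (max (k : ℝ) 1)⁻¹ =
        K₁ * τ ^ (1 - α) * R + C * K₂ * τ ^ (1 - α) * R := by
      rw [hpow, hRdef]; ring
    rw [hgoal, ← localError_sub_affine hT h₁ h₂ w v hτ hcont]
    have hτα := Real.rpow_nonneg hτ.le (1 - α)
    -- `T` need not be bounded on `Y` near `t = 0`, so the propagated local errors are estimated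
    -- from their norms in `X`
    rcases Nat.eq_zero_or_pos (n - 1 - k) with hj | hj
    · obtain ⟨y, hy, hyn⟩ := hK₁ τ hτ hτt _ R hcont' hwv
      refine ⟨y, ?_, hyn.trans (le_add_of_nonneg_right (by positivity))⟩
      simp [hj, hT.map_zero, hy]
    · obtain ⟨d, hd, hdn⟩ := hK₂ τ hτ hτt _ R hcont' hwv
      rw [ContinuousLinearMap.id_apply] at hd
      rw [sub_zero, Real.rpow_one] at hdn
      rw [← hd]
      set j := n - 1 - k with hjdef
      have hj1 : (1 : ℝ) ≤ j := by exact_mod_cast hj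
      have hjn : (j : ℝ) ≤ n := by exact_mod_cast (by omega : j ≤ n)
      have hjτ : τ ≤ j * τ := le_mul_of_one_le_left hτ.le hj1
      have hjt : j * τ ≤ t₀ := (mul_le_mul_of_nonneg_right hjn hτ.le).trans hn
      refine ⟨E (j * τ) d, hE.apply_eq _ (by positivity) hjt d, ?_⟩
      have h1 : ‖E (j * τ)‖ ≤ C * τ ^ (-α) := (hE.norm_le _ (by positivity) hjt).trans
        (mul_le_mul_of_nonneg_left
          (Real.rpow_le_rpow_of_nonpos hτ hjτ (by linarith)) hC0)
      calc ‖E (j * τ) d‖ ≤ C * τ ^ (-α) * (K₂ * τ * R) :=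
            ((E (j * τ)).le_of_opNorm_le h1 d).trans
              (mul_le_mul_of_nonneg_left hdn (mul_nonneg hC0 (Real.rpow_nonneg hτ.le _)))
        _ = C * K₂ * τ ^ (1 - α) * R := by
            rw [sub_eq_neg_add, Real.rpow_add_one hτ.ne']; ring
        _ ≤ _ := le_add_of_nonneg_left (by positivity)
  choose! y hy hyn using hterm
  refine ⟨∑ k ∈ Finset.range n, y k, ?_, ?_⟩
  · rw [numSol_sub_mildSolution hT hτ u₀ n (hgc.mono (Icc_subset_Icc_right hn)), map_sum]
    exact Finset.sum_congr rfl hy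
  · rw [Finset.mul_sum]
    exact (norm_sum_le _ _).trans (Finset.sum_le_sum hyn)

end ERK

end

theorem mainTheorem6
    {X : Type*} [NormedAddCommGroup X] [NormedSpace ℂ X] [CompleteSpace X]
    -- `A` generates the analytic semigroup `T t = e^{tA}` on the Banach space `X`
    (A : X →ₗ.[ℂ] X) (T : ℝ → X →L[ℂ] X)
    (hT : ERK.IsAnalyticSemigroup T) (hA : ERK.IsGenerator T A)
    -- the Banach space `X_α` with `D_A(α,1) ⊂ X_α ⊂ D_A(α,∞)`
    (α : ℝ) (hα₀ : 0 ≤ α) (hα₁ : α < 1)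
    {Xα : Type*} [NormedAddCommGroup Xα] [NormedSpace ℂ Xα] [CompleteSpace Xα]
    (ι : Xα →ₗ[ℂ] X) (hι : ERK.IsIntermediate T A α ι)
    -- the exponential Runge-Kutta method, and the order conditions
    {s : ℕ} (b : Fin s → ℕ →₀ ℂ) (c : Fin s → ℝ) (hc : ∀ i, c i ∈ Set.Icc (0 : ℝ) 1)
    (horder₁ : ∀ z : ℂ, ∑ i, ERK.weight (b i) z = ERK.phi 1 z)
    (horder₂ : ∀ z : ℂ, ∑ i, ERK.weight (b i) z * (c i : ℂ) = ERK.phi 2 z)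
    -- the final time and the bound on the data
    (tEnd : ℝ) (htEnd : 0 < tEnd) (B : ℝ) :
    ∃ C : ℝ, ∀ g g' g'' : ℝ → X,
      (∀ t ∈ Set.Icc 0 tEnd, HasDerivWithinAt g (g' t) (Set.Icc 0 tEnd) t) →
      (∀ t ∈ Set.Ioc 0 tEnd, HasDerivWithinAt g' (g'' t) (Set.Icc 0 tEnd) t) →
      (∀ t ∈ Set.Icc 0 tEnd, ‖g t‖ ≤ B ∧ ‖g' t‖ ≤ B) →
      (∀ t ∈ Set.Ioc 0 tEnd, ‖g'' t‖ ≤ B * t⁻¹) →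
      ∀ (u₀ : Xα) (τ : ℝ), 0 < τ → ∀ n : ℕ, (n : ℝ) * τ ≤ tEnd →
        ∃ un utn : Xα,
          ι un = ERK.numSol T b c g τ (ι u₀) n ∧
          ι utn = ERK.mildSolution T g (ι u₀) (n * τ) ∧
          ‖un - utn‖ ≤ C * τ ^ (2 - α) * (|Real.log τ| + 1) := by
  obtain ⟨J, hJ⟩ := hι.exists_clm
  obtain ⟨C, E, hE⟩ := hι.exists_isSmoothingLift hT hA hα₀ hα₁ hJ tEnd
  obtain ⟨K, hK0, hK⟩ := ERK.exists_error_lift hT hα₀ hα₁ hE b hc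
    (ERK.sum_weights_eq_single horder₁) (ERK.sum_smul_weights_eq_single horder₂)
  refine ⟨K * B * (2 + |Real.log tEnd|), ?_⟩
  intro g g' g'' hg hg' hgB hg'' u₀ τ hτ n hn
  have hB0 : 0 ≤ B := (norm_nonneg _).trans (hgB 0 ⟨le_rfl, htEnd.le⟩).1
  have hτα := Real.rpow_nonneg hτ.le (2 - α)
  rcases n with _ | n
  · refine ⟨u₀, u₀, rfl, by simp [ERK.mildSolution, hT.map_zero], ?_⟩
    rw [sub_self, norm_zero]
    positivity
  have hpos : 0 < ((n + 1 : ℕ) : ℝ) * τ := by positivity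
  -- the exact solution lies in `X_α` because `t_n > 0`
  obtain ⟨-, z, hz, -⟩ := hE.exists_integral_lift hT hα₁ hpos hn (R := B)
    (h := g) (fun t ht => ((hg t ⟨ht.1, ht.2.trans hn⟩).mono
      (Set.Icc_subset_Icc_right hn)).continuousWithinAt)
    (fun t ht => (hgB t ⟨ht.1, ht.2.trans hn⟩).1)
  obtain ⟨y, hy, hyn⟩ := hK B g g' g'' hg hg' (fun t ht => (hgB t ht).2) hg'' (ι u₀) τ hτ _ hn
  have hu : ι (E ((n + 1 : ℕ) * τ) (ι u₀) + z) =
      ERK.mildSolution T g (ι u₀) ((n + 1 : ℕ) * τ) := by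
    rw [← hJ, map_add, hE.apply_eq _ hpos hn, hz, ERK.mildSolution]
  refine ⟨E ((n + 1 : ℕ) * τ) (ι u₀) + z + y, _, ?_, hu, ?_⟩
  · rw [map_add, hu, ← hJ y, hy, add_sub_cancel]
  rw [add_sub_cancel_left]
  have hlog : Real.log (n + 1) ≤ |Real.log tEnd| + |Real.log τ| := by
    have h1 : Real.log ((n + 1) * τ) ≤ Real.log tEnd :=
      Real.log_le_log (by positivity) (by exact_mod_cast hn)
    rw [Real.log_mul (by positivity) hτ.ne'] at h1
    linarith [le_abs_self (Real.log tEnd), neg_abs_le (Real.log τ)]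
  have hsum : ∑ k ∈ Finset.range (n + 1), (max (k : ℝ) 1)⁻¹ ≤
      (2 + |Real.log tEnd|) * (|Real.log τ| + 1) := by
    have h1 := ERK.sum_range_inv_max_le n
    nlinarith [abs_nonneg (Real.log tEnd), abs_nonneg (Real.log τ),
      mul_nonneg (abs_nonneg (Real.log tEnd)) (abs_nonneg (Real.log τ))]
  calc ‖y‖ ≤ K * B * τ ^ (2 - α) * ((2 + |Real.log tEnd|) * (|Real.log τ| + 1)) :=
        hyn.trans (mul_le_mul_of_nonneg_left hsum (by positivity))
    _ = _ := by ring
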